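/- Consider systems of $2n$ bosonic modes with Hilbert space $L^2(\mathbb R^n)\otimes L^2(\mathbb R^n)$, displacement operators $\hat D(\alpha)=\bigotimes_{k=1}^n e^{\alpha_k \hat a_k^\dagger-\alpha_k^*\hat a_k}$ for $\alpha\in\mathbb C^n$, and, for a density operator $\hat\rho_{AB}$ (positive, trace one), the characteristic function $$\chi_{\hat\rho_{AB}}(\alpha,\beta)=\operatorname{Tr}\bigl[\hat\rho_{AB}\,(\hat D(\alpha)\otimes\hat D(\beta))\bigr].$$ The continuous-variable Bell measurement is the positive operator-valued measure on $\mathbb C^n$ $$\hat E(B)=\int_B \hat\Pi(\zeta)\,d^{2n}\zeta,\qquad \hat\Pi(\zeta)=\frac1{\pi^n}(I\otimes\hat D(\zeta))|\Psi\rangle\langle\Psi|(I\otimes\hat D^\dagger(\zeta)),$$ where $|\Psi\rangle=\sum_k|k\rangle|k\rangle=\int_{\mathbb R^n}|x\rangle|x\rangle\,dx$ is the unnormalized infinitely squeezed two-mode vacuum on $n$ pairs of modes, and the formula is understood as a quadratic form on Schwartz functions. Write $\zeta\cdot\alpha=\sum_k\zeta_k\alpha_k$. **Theorem.** For every $r>1$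 there is a constant $C>0$, depending only on $r$, such that the following holds for every $n$. The Bell measurement exists as a positive operator-valued measure. For every $2n$-mode state $\hat\rho_{AB}$, $\chi_{\hat\rho_{AB}}$ is well defined, and the Bell measurement on $\hat\rho_{AB}$ has an outcome distribution $P$, a probability measure on $\mathbb C^n$ with $P(B)=\operatorname{Tr}[\hat\rho_{AB}\hat E(B)]$ for all Borel sets $B$. Let $\zeta_1,\dots,\zeta_N$ be the independent outcomes, each with law $P$, of the Bell measurement on $N$ copies of $\hat\rho_{AB}$, and let $$\tilde\chi(\alpha)=\frac1N\sum_{j=1}^N e^{\zeta_j^*\cdot\alpha^*-\zeta_j\cdot\alpha}.$$ 1. For all $N\ge1$ and $\alpha\in\mathbb C^n$, $\tilde\chi(\alpha)$ is integrable and $\mathbb E[\tilde\chi(\alpha)]=\chi_{\hat\rho_{AB}}(\alpha,\alpha^*)$. 2. For all $\varepsilon,\delta>0$ and all integers $M,N\ge 0$ with $M/\delta\ge r$ and $N\ge C\varepsilon^{-2}\log(M/\delta)$, and for all points $\alpha_1,\dots,\alpha_M\in\mathbb C^n$, $$\Pr\Bigl[\,|\tilde\chi(\alpha_i)-\chi_{\hat\rho_{AB}}(\alpha_i,\alpha_i^*)|\le\varepsilon\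 \text{ for all } i=1,\dots,M\Bigr]\ \ge\ 1-\delta .$$ In particular $N=O(\varepsilon^{-2}\log(M/\delta))$ copies suffice, with a constant independent of $n$, $\hat\rho_{AB}$ and the points. -/

import Mathlib

open MeasureTheory
open scoped InnerProductSpace ENNReal SchwartzMap

noncomputable section

/-- The Hilbert space `L²(ℝ^ι)` of a bosonic system whose modes are indexed by `ι`, in the
Schrödinger (position) representation: the quadratures are `x_k` (multiplication) and
`p_k = -i ∂/∂x_k`, and the annihilation operators are `a_k = (x_k + i p_k) / √2`. -/
abbrev ModeSpace (ι : Type) [Fintype ι] : Type :=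
  Lp ℂ 2 (volume : Measure (EuclideanSpace ℝ ι))

/-- The point `√2 Re α` of position space by which the displacement `α` shifts. -/
def positionShift {ι : Type} (α : ι → ℂ) : EuclideanSpace ℝ ι :=
  WithLp.toLp 2 fun k => Real.sqrt 2 * (α k).re

/-- The phase `exp (-i Re α · Im α + i √2 Im α · x)`. -/
def displacementPhase {ι : Type} [Fintype ι] (α : ι → ℂ) (x : EuclideanSpace ℝ ι) : ℂ :=
  Complex.exp
    (((-(∑ k, (α k).re * (α k).im) + Real.sqrt 2 * ∑ k, (α k).im * x k : ℝ) : ℂ) * Complex.I)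

/-- The displacement operator `⨂_k exp (α_k a_k† - α_k^* a_k)` on wave functions: since
`α a† - α^* a = i √2 (Im α) x - √2 (Re α) ∂/∂x`, it sends `f` to
`x ↦ exp (-i Re α · Im α + i √2 Im α · x) f (x - √2 Re α)`. -/
def displaceFun {ι : Type} [Fintype ι] (α : ι → ℂ) (f : EuclideanSpace ℝ ι → ℂ)
    (x : EuclideanSpace ℝ ι) : ℂ :=
  displacementPhase α x * f (x - positionShift α)

theorem norm_displacementPhase {ι : Type} [Fintype ι] (α : ι → ℂ) (x : EuclideanSpace ℝ ι) :
    ‖displacementPhase α x‖ = 1 :=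
  Complex.norm_exp_ofReal_mul_I _

theorem continuous_displacementPhase {ι : Type} [Fintype ι] (α : ι → ℂ) :
    Continuous (displacementPhase α) := by
  unfold displacementPhase
  fun_prop

theorem measurePreserving_shift {ι : Type} [Fintype ι] (α : ι → ℂ) :
    MeasurePreserving (fun x : EuclideanSpace ℝ ι => x - positionShift α) volume volume :=
  measurePreserving_sub_right volume (positionShift α)

theorem memLp_displaceFun {ι : Type} [Fintype ι] (α : ι → ℂ) {f : EuclideanSpace ℝ ι → ℂ}
    (hf : MemLp f 2 volume) : MemLp (displaceFun α f) 2 volume := by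
  have h := hf.comp_measurePreserving (measurePreserving_shift α)
  refine MemLp.of_le h
    ((continuous_displacementPhase α).aestronglyMeasurable.mul h.aestronglyMeasurable) ?_
  refine Filter.Eventually.of_forall fun x => ?_
  simp [displaceFun, norm_displacementPhase]

theorem displaceFun_congr_ae {ι : Type} [Fintype ι] (α : ι → ℂ)
    {f g : EuclideanSpace ℝ ι → ℂ} (h : f =ᵐ[volume] g) :
    displaceFun α f =ᵐ[volume] displaceFun α g := by
  filter_upwards [(measurePreserving_shift α).quasiMeasurePreserving.ae_eq_comp h] with x hx
  simp only [Function.comp_apply] at hx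
  simp [displaceFun, hx]

/-- The displacement operator `D(α)` as a bounded operator on `L²(ℝ^ι)`. When
`ι = ι₁ ⊕ ι₂`, `displacement (Sum.elim α β)` is `D(α) ⊗ D(β)`. -/
def displacement {ι : Type} [Fintype ι] (α : ι → ℂ) : ModeSpace ι →L[ℂ] ModeSpace ι :=
  LinearMap.mkContinuous
    { toFun := fun ψ => (memLp_displaceFun α (Lp.memLp ψ)).toLp
      map_add' := fun ψ φ => by
        rw [← MemLp.toLp_add]
        refine MemLp.toLp_congr _ _ ((displaceFun_congr_ae α (Lp.coeFn_add ψ φ)).trans ?_)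
        exact Filter.Eventually.of_forall fun x => by simp [displaceFun, mul_add]
      map_smul' := fun c ψ => by
        rw [RingHom.id_apply, ← MemLp.toLp_const_smul]
        refine MemLp.toLp_congr _ _ ((displaceFun_congr_ae α (Lp.coeFn_smul c ψ)).trans ?_)
        exact Filter.Eventually.of_forall fun x => by simp [displaceFun, mul_left_comm] }
    1 fun ψ => by
      have h := (Lp.memLp ψ).comp_measurePreserving (measurePreserving_shift α)
      have e : eLpNorm (displaceFun α ψ) 2 volume = eLpNorm ψ 2 volume := by
        rw [← eLpNorm_comp_measurePreserving (Lp.aestronglyMeasurable ψ)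
          (measurePreserving_shift α)]
        refine eLpNorm_congr_norm_ae (Filter.Eventually.of_forall fun x => ?_)
        simp [displaceFun, norm_displacementPhase]
      simp only [LinearMap.coe_mk, AddHom.coe_mk, Lp.norm_toLp, one_mul]
      rw [e, Lp.norm_def]

/-- `T` has trace `t`: the diagonal matrix elements of `T` sum to `t` in every orthonormal
(Hilbert) basis. -/
def HasTrace {H : Type} [NormedAddCommGroup H] [InnerProductSpace ℂ H]
    (T : H →L[ℂ] H) (t : ℂ) : Prop :=
  ∀ (κ : Type) (b : HilbertBasis κ ℂ H), HasSum (fun i => ⟪b i, T (b i)⟫_ℂ) t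

open Classical in
/-- The trace of `T` (`0` if `T` has no trace). -/
def opTrace {H : Type} [NormedAddCommGroup H] [InnerProductSpace ℂ H] (T : H →L[ℂ] H) : ℂ :=
  if h : ∃ t, HasTrace T t then h.choose else 0

/-- A quantum state: a positive operator of trace one. -/
structure DensityOperator (H : Type) [NormedAddCommGroup H] [InnerProductSpace ℂ H] where
  op : H →L[ℂ] H
  isPositive : op.IsPositive
  trace_one : HasTrace op 1

/-- The characteristic function `χ_ρ(α, β) = Tr[ρ (D(α) ⊗ D(β))]` of a state of `2n` modes. -/
def charFn {n : ℕ} (ρ : DensityOperator (ModeSpace (Fin n ⊕ Fin n))) (α β : Fin n → ℂ) : ℂ :=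
  opTrace (ρ.op ∘L displacement (Sum.elim α β))

/-- A quantum measurement (positive operator-valued measure) on `H` with outcomes in `X`.
Only the values of `effect` on measurable sets matter. -/
structure POVM (X : Type) [MeasurableSpace X]
    (H : Type) [NormedAddCommGroup H] [InnerProductSpace ℂ H] where
  effect : Set X → H →L[ℂ] H
  isPositive : ∀ B, MeasurableSet B → (effect B).IsPositive
  effect_univ : effect Set.univ = ContinuousLinearMap.id ℂ H
  hasSum_effect : ∀ B : ℕ → Set X, (∀ i, MeasurableSet (B i)) →
    (∀ i j, i ≠ j → Disjoint (B i) (B j)) →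
    ∀ φ ψ : H, HasSum (fun i => ⟪φ, effect (B i) ψ⟫_ℂ) ⟪φ, effect (⋃ i, B i) ψ⟫_ℂ

/-- Born rule: `P` is the distribution of the outcome of the measurement `E` on the state `ρ`,
that is, `P(B) = Tr[ρ E(B)]`. -/
def POVM.IsOutcomeLaw {X : Type} [MeasurableSpace X]
    {H : Type} [NormedAddCommGroup H] [InnerProductSpace ℂ H]
    (E : POVM X H) (ρ : DensityOperator H) (P : Measure X) : Prop :=
  IsProbabilityMeasure P ∧
    ∀ B, MeasurableSet B → HasTrace (ρ.op ∘L E.effect B) ((P.real B : ℝ) : ℂ)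

/-- The pairing `⟨Ψ(ζ)|f⟩ = ⟨Ψ| (I ⊗ D(ζ)†) f⟩` of a Schwartz function of `2n` modes with the
displaced, infinitely squeezed two-mode vacuum `|Ψ(ζ)⟩ = (I ⊗ D(ζ))|Ψ⟩`. The unnormalized
vector `|Ψ⟩ = ∑_k |k⟩|k⟩ = ∫ |x⟩|x⟩ dx` acts by `⟨Ψ|f⟩ = ∫ f(x, x) dx`, and
`D(ζ)† = D(-ζ)`. -/
def bellAmplitude {n : ℕ} (ζ : Fin n → ℂ)
    (f : 𝓢(EuclideanSpace ℝ (Fin n ⊕ Fin n), ℂ)) : ℂ :=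
  ∫ x : EuclideanSpace ℝ (Fin n),
    displaceFun (Sum.elim (0 : Fin n → ℂ) (-ζ)) f (WithLp.toLp 2 (Sum.elim x x))

/-- `E` is the continuous-variable Bell measurement
`E(B) = ∫_B π^{-n} |Ψ(ζ)⟩⟨Ψ(ζ)| d^{2n}ζ`, as a quadratic form on the dense subspace of
Schwartz functions, on which `⟨Ψ(ζ)|` is defined. -/
def IsBellMeasurement {n : ℕ}
    (E : POVM (Fin n → ℂ) (ModeSpace (Fin n ⊕ Fin n))) : Prop :=
  ∀ f : 𝓢(EuclideanSpace ℝ (Fin n ⊕ Fin n), ℂ), ∀ B : Set (Fin n → ℂ), MeasurableSet B →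
    ENNReal.ofReal (⟪f.toLp 2, E.effect B (f.toLp 2)⟫_ℂ).re =
      ∫⁻ ζ in B, ENNReal.ofReal ((1 / Real.pi ^ n) * ‖bellAmplitude ζ f‖ ^ 2)

/-- The estimator `(1/N) ∑_j exp (ζ_j^* · α^* - ζ_j · α)` computed from the outcomes
`ζ_1, …, ζ_N`, where `ζ · α = ∑_k ζ_k α_k`. -/
def bellEstimator {n N : ℕ} (ζ : Fin N → Fin n → ℂ) (α : Fin n → ℂ) : ℂ :=
  (1 / (N : ℂ)) * ∑ j, Complex.exp
    (∑ k, (starRingEnd ℂ (ζ j k) * starRingEnd ℂ (α k) - ζ j k * α k))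

end

/-! The Bell measurement is diagonalized by an isometry. Up to a unimodular phase and a linear
change of variables, `ζ ↦ ⟨Ψ(ζ)|f⟩` is the Fourier transform of `f` along the translates of the
diagonal. Plancherel therefore makes `f ↦ π^{-n/2} ⟨Ψ(·)|f⟩` an isometry `V` from `L²(ℝ^{2n})` to
`L²(ℂ^n)` (`lintegral_norm_sq_bellAmplitude`, `bellTransform`), and the effects are `V* 1_B V`.
Surjectivity of `V` is never needed.

Under `V` the operator `D(α) ⊗ D(α^*)` becomes multiplication by the unimodular character `bellChar
α` (`bellTransform_displacement`). Writing `ρ = ∑_j |v_j⟩⟨v_j|`, the outcome law `P` has density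
`∑_j |V v_j|²`, and `∫ bellChar α dP = Tr[ρ (D(α) ⊗ D(α^*))]` (`integral_bellLaw`).

The estimator is thus an empirical mean of independent variables of modulus one with the desired
expectation. Hoeffding's inequality and a union bound over the `M` points finish the proof; the
dimension plays no role because the bound on the variables is always one. -/

theorem HilbertBasis.hasSum_norm_inner_sq {κ H : Type*} [NormedAddCommGroup H]
    [InnerProductSpace ℂ H] (b : HilbertBasis κ ℂ H) (x : H) :
    HasSum (fun i => ‖⟪b i, x⟫_ℂ‖ ^ 2) (‖x‖ ^ 2) := by
  have h := Complex.hasSum_re (b.hasSum_inner_mul_inner x x)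
  have h2 : (⟪x, x⟫_ℂ).re = ‖x‖ ^ 2 := by
    simpa using inner_self_eq_norm_sq (𝕜 := ℂ) x
  rw [h2] at h
  refine h.congr_fun fun i => ?_
  rw [← inner_conj_symm x (b i), ← Complex.normSq_eq_conj_mul_self, Complex.ofReal_re,
    Complex.normSq_eq_norm_sq]

/-! ### Traces of products with a state. -/

section Trace

variable {H : Type} [NormedAddCommGroup H] [InnerProductSpace ℂ H] [CompleteSpace H]

theorem HasTrace.unique {T : H →L[ℂ] H} {s t : ℂ} (hs : HasTrace T s) (ht : HasTrace T t) :
    s = t := by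
  obtain ⟨w, b, -⟩ := exists_hilbertBasis ℂ H
  exact (hs w b).unique (ht w b)

theorem HasTrace.opTrace_eq {T : H →L[ℂ] H} {t : ℂ} (h : HasTrace T t) : opTrace T = t := by
  have hex : ∃ t, HasTrace T t := ⟨t, h⟩
  rw [opTrace, dif_pos hex]
  exact hex.choose_spec.unique h

/-- Every state is a mixture `∑_j |v_j⟩⟨v_j|` of (unnormalized) pure states. -/
theorem DensityOperator.exists_ensemble (ρ : DensityOperator H) :
    ∃ (κ : Type) (v : κ → H), HasSum (fun j => ‖v j‖ ^ 2) 1 ∧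
      ∀ x y, HasSum (fun j => ⟪x, v j⟫_ℂ * ⟪v j, y⟫_ℂ) ⟪x, ρ.op y⟫_ℂ := by
  obtain ⟨w, b, -⟩ := exists_hilbertBasis ℂ H
  have hρ : 0 ≤ ρ.op := (ContinuousLinearMap.nonneg_iff_isPositive _).2 ρ.isPositive
  set S := CFC.sqrt ρ.op
  have hSS : S * S = ρ.op := CFC.sqrt_mul_sqrt_self _ hρ
  have hS : ∀ x y, ⟪S x, y⟫_ℂ = ⟪x, S y⟫_ℂ :=
    ((ContinuousLinearMap.nonneg_iff_isPositive _).1 (CFC.sqrt_nonneg ρ.op)).isSymmetric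
  have hin : ∀ x y, ⟪S x, S y⟫_ℂ = ⟪x, ρ.op y⟫_ℂ := fun x y => by
    rw [hS, ← hSS]; rfl
  -- The ensemble is `v_j = √ρ b_j`: its total weight is the trace of `ρ`, and its resolution of `ρ`
  -- is Parseval's identity for `√ρ x` and `√ρ y`.
  refine ⟨w, fun j => S (b j), ?_, fun x y => ?_⟩
  · refine (Complex.hasSum_re (ρ.trace_one w b)).congr_fun fun j => ?_
    rw [← hin]
    simpa using (inner_self_eq_norm_sq (𝕜 := ℂ) (S (b j))).symm
  · rw [← hin]
    refine (b.hasSum_inner_mul_inner (S x) (S y)).congr_fun fun j => ?_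
    rw [hS, hS]

/-- Both sides are iterated sums of the double series `⟨b_i, v_j⟩⟨v_j, T b_i⟩`. It converges
absolutely, since `|xy| ≤ |x|² + |y|²` and Parseval bound it by `∑ ‖v_j‖² + ∑ ‖T* v_j‖²`, so the
order of summation is free and the value does not depend on the basis. -/
theorem hasTrace_comp_of_ensemble {A : H →L[ℂ] H} {κ : Type} {v : κ → H}
    (hv : Summable fun j => ‖v j‖ ^ 2)
    (hA : ∀ x y, HasSum (fun j => ⟪x, v j⟫_ℂ * ⟪v j, y⟫_ℂ) ⟪x, A y⟫_ℂ) (T : H →L[ℂ] H) :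
    HasTrace (A ∘L T) (∑' j, ⟪v j, T (v j)⟫_ℂ) := by
  intro ι b
  have hsq : ∀ u : κ → H, (Summable fun j => ‖u j‖ ^ 2) →
      Summable fun p : κ × ι => ‖⟪b p.2, u p.1⟫_ℂ‖ ^ 2 := fun u hu => by
    refine (summable_prod_of_nonneg fun p => by positivity).2
      ⟨fun j => (b.hasSum_norm_inner_sq (u j)).summable, ?_⟩
    simpa only [(b.hasSum_norm_inner_sq _).tsum_eq] using hu
  set T' := ContinuousLinearMap.adjoint T
  have hT' : Summable fun j => ‖T' (v j)‖ ^ 2 := by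
    refine Summable.of_nonneg_of_le (fun j => by positivity) (fun j => ?_)
      (hv.mul_left (‖T'‖ ^ 2))
    rw [← mul_pow]
    gcongr
    exact T'.le_opNorm _
  have hsum : Summable fun p : κ × ι => ⟪b p.2, v p.1⟫_ℂ * ⟪v p.1, T (b p.2)⟫_ℂ := by
    refine Summable.of_norm_bounded ((hsq _ hv).add (hsq _ hT')) fun p => ?_
    have h2 : ‖⟪v p.1, T (b p.2)⟫_ℂ‖ = ‖⟪b p.2, T' (v p.1)⟫_ℂ‖ := by
      rw [← ContinuousLinearMap.adjoint_inner_left, norm_inner_symm]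
    rw [norm_mul, h2]
    nlinarith [sq_nonneg (‖⟪b p.2, v p.1⟫_ℂ‖ - ‖⟪b p.2, T' (v p.1)⟫_ℂ‖),
      sq_nonneg (‖⟪b p.2, v p.1⟫_ℂ‖), sq_nonneg ‖⟪b p.2, T' (v p.1)⟫_ℂ‖]
  have h1 := hsum.hasSum.prod_fiberwise (g := fun j => ⟪v j, T (v j)⟫_ℂ) fun j => by
    rw [← ContinuousLinearMap.adjoint_inner_left]
    refine (b.hasSum_inner_mul_inner (T' (v j)) (v j)).congr_fun fun i => ?_
    rw [mul_comm, ContinuousLinearMap.adjoint_inner_left]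
  rw [h1.tsum_eq]
  exact ((Equiv.prodComm ι κ).hasSum_iff.2 hsum.hasSum).prod_fiberwise fun i => hA (b i) (T (b i))

end Trace

/-! ### Concentration of empirical means. -/

section Hoeffding

variable {X : Type*} [MeasurableSpace X] (P : Measure X) [IsProbabilityMeasure P]

theorem measureReal_pi_sum_ge_le {f : X → ℝ} (hf : Measurable f) (hb : ∀ x, |f x| ≤ 1) (N : ℕ)
    {t : ℝ} (ht : 0 ≤ t) :
    (Measure.pi fun _ : Fin N => P).real {ζ | t ≤ ∑ j, (f (ζ j) - ∫ x, f x ∂P)} ≤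
      Real.exp (-t ^ 2 / (2 * N)) := by
  have hind : ProbabilityTheory.iIndepFun
      (fun (j : Fin N) (ζ : Fin N → X) => f (ζ j) - ∫ x, f x ∂P) (Measure.pi fun _ => P) :=
    ProbabilityTheory.iIndepFun_pi (X := fun _ x => f x - ∫ x, f x ∂P)
      fun _ => (hf.sub_const _).aemeasurable
  have hsub : ∀ j ∈ (Finset.univ : Finset (Fin N)), ProbabilityTheory.HasSubgaussianMGF
      (fun ζ : Fin N → X => f (ζ j) - ∫ x, f x ∂P) 1 (Measure.pi fun _ => P) := fun j _ => by
    have h := ProbabilityTheory.hasSubgaussianMGF_of_mem_Icc (μ := Measure.pi fun _ : Fin N => P)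
      (X := fun ζ => f (ζ j)) (a := -1) (b := 1)
      (hf.comp (measurable_pi_apply j)).aemeasurable
      (Filter.Eventually.of_forall fun ζ => abs_le.1 (hb _))
    have hint : ∫ ζ : Fin N → X, f (ζ j) ∂(Measure.pi fun _ => P) = ∫ x, f x ∂P := by
      exact integral_comp_eval (μ := fun _ : Fin N => P) hf.aestronglyMeasurable
    rw [hint] at h
    -- Values in `[-1, 1]` give the sub-Gaussian parameter `((1 - (-1)) / 2)² = 1`.
    convert h using 1
    norm_num
  have h := ProbabilityTheory.HasSubgaussianMGF.measure_sum_ge_le_of_iIndepFun hind hsub ht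
  simpa using h

theorem measureReal_pi_abs_mean_sub_gt_le {f : X → ℝ} (hf : Measurable f) (hb : ∀ x, |f x| ≤ 1)
    {N : ℕ} (hN : 0 < N) {s : ℝ} (hs : 0 ≤ s) :
    (Measure.pi fun _ : Fin N => P).real
        {ζ | s < |(N : ℝ)⁻¹ * ∑ j, f (ζ j) - ∫ x, f x ∂P|} ≤
      2 * Real.exp (-(N * s ^ 2) / 2) := by
  have hN' : (0 : ℝ) < N := Nat.cast_pos.2 hN
  have hexp : -(N * s) ^ 2 / (2 * N) = -(N * s ^ 2) / 2 := by field_simp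
  have h1 := measureReal_pi_sum_ge_le P hf hb N (t := N * s) (by positivity)
  have h2 := measureReal_pi_sum_ge_le P (f := fun x => -f x) hf.neg (fun x => by simpa using hb x)
    N (t := N * s) (by positivity)
  rw [hexp] at h1 h2
  calc _ ≤ (Measure.pi fun _ : Fin N => P).real
        ({ζ | N * s ≤ ∑ j, (f (ζ j) - ∫ x, f x ∂P)} ∪
          {ζ | N * s ≤ ∑ j, (-f (ζ j) - ∫ x, -f x ∂P)}) := by
        refine measureReal_mono fun ζ hζ => ?_
        simp only [Set.mem_ofPred_eq, Set.mem_union, Finset.sum_sub_distrib, integral_neg,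
          Finset.sum_const, Finset.card_univ, Fintype.card_fin, nsmul_eq_mul,
          Finset.sum_neg_distrib] at hζ ⊢
        have hm : (N : ℝ) * ((N : ℝ)⁻¹ * ∑ j, f (ζ j)) = ∑ j, f (ζ j) := by field_simp
        rcases lt_abs.1 hζ with h | h
        · left; nlinarith [mul_lt_mul_of_pos_left h hN']
        · right; nlinarith [mul_lt_mul_of_pos_left h hN']
    _ ≤ _ := (measureReal_union_le _ _).trans (by linarith)

/-- Hoeffding's inequality for the mean of independent copies of a complex random variable. -/
theorem measureReal_pi_norm_mean_sub_gt_le {g : X → ℂ} (hg : Measurable g) (hb : ∀ x, ‖g x‖ ≤ 1)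
    {N : ℕ} (hN : 0 < N) {ε : ℝ} (hε : 0 ≤ ε) :
    (Measure.pi fun _ : Fin N => P).real
        {ζ | ε < ‖(1 / (N : ℂ)) * ∑ j, g (ζ j) - ∫ x, g x ∂P‖} ≤
      4 * Real.exp (-(N * ε ^ 2) / 4) := by
  have hint : Integrable g P :=
    Integrable.of_bound hg.aestronglyMeasurable 1 (Filter.Eventually.of_forall hb)
  -- If the real and imaginary parts each deviate by at most `ε / √2`, the modulus deviates by at
  -- most `ε`. This halves the exponent and doubles the prefactor.
  have hs2 : (ε / √2) ^ 2 = ε ^ 2 / 2 := by rw [div_pow, Real.sq_sqrt (by norm_num)]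
  have h1 := measureReal_pi_abs_mean_sub_gt_le P (f := fun x => (g x).re)
    (Complex.measurable_re.comp hg) (fun x => (Complex.abs_re_le_norm _).trans (hb x)) hN
    (s := ε / √2) (by positivity)
  have h2 := measureReal_pi_abs_mean_sub_gt_le P (f := fun x => (g x).im)
    (Complex.measurable_im.comp hg) (fun x => (Complex.abs_im_le_norm _).trans (hb x)) hN
    (s := ε / √2) (by positivity)
  have hexp : -(N * (ε / √2) ^ 2) / 2 = -(N * ε ^ 2) / 4 := by rw [hs2]; ring
  rw [hexp] at h1 h2
  refine le_trans (measureReal_mono fun ζ hζ => ?_)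
    ((measureReal_union_le _ _).trans ((add_le_add h1 h2).trans (by linarith)))
  set z := (1 / (N : ℂ)) * ∑ j, g (ζ j) - ∫ x, g x ∂P with hz
  have hre : z.re = (N : ℝ)⁻¹ * ∑ j, (g (ζ j)).re - ∫ x, (g x).re ∂P := by
    have : (∫ x, g x ∂P).re = ∫ x, (g x).re ∂P := (integral_re hint).symm
    rw [hz, Complex.sub_re, this, one_div, ← Complex.ofReal_natCast, ← Complex.ofReal_inv,
      Complex.re_ofReal_mul, Complex.re_sum]
  have him : z.im = (N : ℝ)⁻¹ * ∑ j, (g (ζ j)).im - ∫ x, (g x).im ∂P := by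
    have : (∫ x, g x ∂P).im = ∫ x, (g x).im ∂P := (integral_im hint).symm
    rw [hz, Complex.sub_im, this, one_div, ← Complex.ofReal_natCast, ← Complex.ofReal_inv,
      Complex.im_ofReal_mul, Complex.im_sum]
  by_contra hcon
  simp only [Set.mem_union, Set.mem_ofPred_eq, not_or, not_lt, ← hre, ← him] at hcon hζ
  have hsq : ‖z‖ ^ 2 ≤ ε ^ 2 := by
    rw [← Complex.normSq_eq_norm_sq, Complex.normSq_apply]
    have a1 := sq_le_sq' (by linarith [abs_nonneg z.re, hcon.1]) hcon.1
    have a2 := sq_le_sq' (by linarith [abs_nonneg z.im, hcon.2]) hcon.2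
    rw [hs2, sq_abs] at a1 a2
    nlinarith
  exact absurd (abs_le_of_sq_le_sq' hsq hε).2 (not_le.2 hζ)

/-- Simultaneous estimation of `M` means, with a sample size logarithmic in `M / δ`. -/
theorem one_sub_le_measureReal_pi_mean_close {r : ℝ} (hr : 1 < r) {ε δ : ℝ} {M N : ℕ}
    (hε : 0 < ε) (hδ : 0 < δ) (hM : r ≤ M / δ)
    (hN : 4 * (1 + Real.log 4 / Real.log r) * (ε ^ 2)⁻¹ * Real.log (M / δ) ≤ N)
    {g : Fin M → X → ℂ} (hg : ∀ i, Measurable (g i)) (hb : ∀ i x, ‖g i x‖ ≤ 1) :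
    1 - δ ≤ (Measure.pi fun _ : Fin N => P).real
      {ζ | ∀ i, ‖(1 / (N : ℂ)) * ∑ j, g i (ζ j) - ∫ x, g i x ∂P‖ ≤ ε} := by
  have hlr : 0 < Real.log r := Real.log_pos hr
  have hMδ : 0 < (M : ℝ) / δ := by linarith
  have hl : Real.log r ≤ Real.log (M / δ) := Real.log_le_log (by linarith) hM
  have hl4 : 0 < Real.log 4 := Real.log_pos (by norm_num)
  have hNpos : 0 < N := by
    have : (0 : ℝ) < N := lt_of_lt_of_le (by have := hlr.trans_le hl; positivity) hN
    exact_mod_cast this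
  have hMpos : 0 < (M : ℝ) := by
    have := mul_pos hMδ hδ
    rwa [div_mul_cancel₀ _ hδ.ne'] at this
  -- The prefactor `4` of the tail bound adds `log 4`, which `M / δ ≥ r > 1` absorbs into a multiple
  -- of `log (M / δ)`. This is where the constant `4 * (1 + log 4 / log r)` comes from; its leading
  -- `4` cancels the one in the exponent.
  have hkey : Real.log (4 * (M / δ)) ≤ N * ε ^ 2 / 4 := by
    rw [Real.log_mul (by norm_num) hMδ.ne']
    have h1 : Real.log 4 ≤ Real.log 4 / Real.log r * Real.log (M / δ) := by
      rw [div_mul_eq_mul_div, le_div_iff₀ hlr]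
      gcongr
    have h2 := mul_le_mul_of_nonneg_right hN (by positivity : 0 ≤ ε ^ 2)
    have h3 : 4 * (1 + Real.log 4 / Real.log r) * (ε ^ 2)⁻¹ * Real.log (M / δ) * ε ^ 2 =
        4 * ((1 + Real.log 4 / Real.log r) * Real.log (M / δ)) := by field_simp
    rw [h3] at h2
    linarith
  have hbad : ∀ i, (Measure.pi fun _ : Fin N => P).real
      {ζ | ε < ‖(1 / (N : ℂ)) * ∑ j, g i (ζ j) - ∫ x, g i x ∂P‖} ≤ δ / M := fun i => by
    refine (measureReal_pi_norm_mean_sub_gt_le P (hg i) (hb i) hNpos hε.le).trans ?_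
    have h1 : Real.exp (-(N * ε ^ 2) / 4) ≤ (4 * (M / δ))⁻¹ := by
      rw [← Real.exp_log (show 0 < 4 * (M / δ) by positivity), ← Real.exp_neg]
      exact Real.exp_le_exp.2 (by linarith)
    calc _ ≤ 4 * (4 * ((M : ℝ) / δ))⁻¹ := by gcongr
      _ = δ / M := by field_simp
  have hU : (Measure.pi fun _ : Fin N => P).real
      (⋃ i, {ζ | ε < ‖(1 / (N : ℂ)) * ∑ j, g i (ζ j) - ∫ x, g i x ∂P‖}) ≤ δ := by
    refine (measureReal_iUnion_fintype_le _).trans ((Finset.sum_le_sum fun i _ => hbad i).trans ?_)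
    rw [Finset.sum_const, Finset.card_univ, Fintype.card_fin, nsmul_eq_mul]
    exact (mul_div_cancel₀ _ hMpos.ne').le
  have hmeas : MeasurableSet
      (⋃ i, {ζ : Fin N → X | ε < ‖(1 / (N : ℂ)) * ∑ j, g i (ζ j) - ∫ x, g i x ∂P‖}) := by
    refine MeasurableSet.iUnion fun i => measurableSet_lt measurable_const ?_
    have : Measurable fun ζ : Fin N → X => ∑ j, g i (ζ j) :=
      Finset.measurable_sum _ fun j _ => (hg i).comp (measurable_pi_apply j)
    fun_prop
  have hc := probReal_compl_eq_one_sub (μ := Measure.pi fun _ : Fin N => P) hmeas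
  have hset : (⋃ i, {ζ : Fin N → X | ε < ‖(1 / (N : ℂ)) * ∑ j, g i (ζ j) - ∫ x, g i x ∂P‖})ᶜ =
      {ζ | ∀ i, ‖(1 / (N : ℂ)) * ∑ j, g i (ζ j) - ∫ x, g i x ∂P‖ ≤ ε} := by
    ext ζ
    simp
  rw [← hset, hc]
  linarith

end Hoeffding

/-! ### The Bell amplitude as a partial Fourier transform. -/

noncomputable section BellTransform

open FourierTransform

variable {n : ℕ}

theorem lintegral_comp_smul_of_pos {E : Type*} [NormedAddCommGroup E] [NormedSpace ℝ E]
    [MeasurableSpace E] [BorelSpace E] [FiniteDimensional ℝ E] (μ : Measure E)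
    [μ.IsAddHaarMeasure] (f : E → ℝ≥0∞) {R : ℝ} (hR : 0 < R) :
    ∫⁻ x, f (R • x) ∂μ = ENNReal.ofReal ((R ^ Module.finrank ℝ E)⁻¹) * ∫⁻ x, f x ∂μ := by
  have h := lintegral_map_equiv f (Homeomorph.smulOfNeZero R hR.ne').toMeasurableEquiv (μ := μ)
  change ∫⁻ x, f x ∂(Measure.map (R • ·) μ) = ∫⁻ x, f (R • x) ∂μ at h
  rw [← h, Measure.map_addHaar_smul μ hR.ne', lintegral_smul_measure, abs_of_pos (by positivity),
    smul_eq_mul]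

theorem SchwartzMap.lintegral_norm_sq_fourier {V : Type*} [NormedAddCommGroup V]
    [InnerProductSpace ℝ V] [FiniteDimensional ℝ V] [MeasurableSpace V] [BorelSpace V]
    (f : 𝓢(V, ℂ)) :
    ∫⁻ ξ, ENNReal.ofReal (‖𝓕 f ξ‖ ^ 2) = ∫⁻ x, ENNReal.ofReal (‖f x‖ ^ 2) := by
  have h : ∀ g : 𝓢(V, ℂ), ∫⁻ x, ENNReal.ofReal (‖g x‖ ^ 2) = ENNReal.ofReal (∫ x, ‖g x‖ ^ 2) :=
    fun g => (ofReal_integral_eq_lintegral_ofReal ((g.memLp 2).integrable_norm_pow (by norm_num))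
      (Filter.Eventually.of_forall fun x => by positivity)).symm
  rw [h, h, SchwartzMap.integral_norm_sq_fourier]

/-- The point `(x, x + q)` of the position space of two sets of modes. -/
def diagShift (q x : EuclideanSpace ℝ (Fin n)) : EuclideanSpace ℝ (Fin n ⊕ Fin n) :=
  WithLp.toLp 2 (Sum.elim x (x + q))

theorem continuous_diagShift :
    Continuous fun p : EuclideanSpace ℝ (Fin n) × EuclideanSpace ℝ (Fin n) =>
      diagShift p.1 p.2 := by
  unfold diagShift
  refine (PiLp.continuous_toLp 2 _).comp (continuous_pi fun i => ?_)
  rcases i with i | i <;> simp only [Sum.elim_inl, Sum.elim_inr] <;> fun_prop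

/-- The first block of coordinates already recovers `x`. This bound ensures that restricting a
Schwartz function to a shifted diagonal leaves it Schwartz. -/
theorem antilipschitzWith_diagShift (q : EuclideanSpace ℝ (Fin n)) :
    AntilipschitzWith 1 (diagShift q) := by
  refine AntilipschitzWith.of_le_mul_dist fun x y => ?_
  rw [NNReal.coe_one, one_mul, EuclideanSpace.dist_eq, EuclideanSpace.dist_eq]
  refine Real.sqrt_le_sqrt ?_
  rw [Fintype.sum_sum_type]
  simp only [diagShift, Sum.elim_inl]
  exact le_add_of_nonneg_right (Finset.sum_nonneg fun i _ => by positivity)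

theorem hasTemperateGrowth_diagShift (q : EuclideanSpace ℝ (Fin n)) :
    Function.HasTemperateGrowth (diagShift q) := by
  let L : EuclideanSpace ℝ (Fin n) →ₗ[ℝ] EuclideanSpace ℝ (Fin n ⊕ Fin n) :=
    { toFun := diagShift 0
      map_add' := fun x y => by
        ext i; rcases i with i | i <;> simp [diagShift]
      map_smul' := fun c x => by
        ext i; rcases i with i | i <;> simp [diagShift] }
  have h : diagShift q = fun x => LinearMap.toContinuousLinearMap L x + diagShift q 0 := by
    ext x i
    rcases i with i | i <;> simp [L, diagShift]
  rw [h]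
  exact (ContinuousLinearMap.hasTemperateGrowth _).add (Function.HasTemperateGrowth.const _)

/-- The section `x ↦ f (x, x + q)` of a Schwartz function. -/
def diagSection (q : EuclideanSpace ℝ (Fin n)) :
    𝓢(EuclideanSpace ℝ (Fin n ⊕ Fin n), ℂ) →L[ℂ] 𝓢(EuclideanSpace ℝ (Fin n), ℂ) :=
  SchwartzMap.compCLMOfAntilipschitz ℂ (hasTemperateGrowth_diagShift q)
    (antilipschitzWith_diagShift q)

theorem diagSection_apply (q : EuclideanSpace ℝ (Fin n))
    (f : 𝓢(EuclideanSpace ℝ (Fin n ⊕ Fin n), ℂ)) (x : EuclideanSpace ℝ (Fin n)) :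
    diagSection q f x = f (diagShift q x) := rfl

theorem measurePreserving_re_im :
    MeasurePreserving (fun ζ : Fin n → ℂ =>
      ((WithLp.toLp 2 fun k => (ζ k).re : EuclideanSpace ℝ (Fin n)),
        (WithLp.toLp 2 fun k => (ζ k).im : EuclideanSpace ℝ (Fin n)))) :=
  ((PiLp.volume_preserving_toLp (Fin n)).prod (PiLp.volume_preserving_toLp (Fin n))).comp
    ((volume_measurePreserving_arrowProdEquivProdArrow ℝ ℝ (Fin n)).comp
      (volume_preserving_pi fun _ => Complex.volume_preserving_equiv_real_prod))

theorem measurePreserving_toLp_sumElim :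
    MeasurePreserving (fun p : EuclideanSpace ℝ (Fin n) × EuclideanSpace ℝ (Fin n) =>
      (WithLp.toLp 2 (Sum.elim p.1 p.2) : EuclideanSpace ℝ (Fin n ⊕ Fin n))) := by
  have h := (PiLp.volume_preserving_toLp (Fin n ⊕ Fin n)).comp
    ((volume_measurePreserving_sumPiEquivProdPi_symm fun _ : Fin n ⊕ Fin n => ℝ).comp
      ((PiLp.volume_preserving_ofLp (Fin n)).prod (PiLp.volume_preserving_ofLp (Fin n))))
  have he : (fun p : EuclideanSpace ℝ (Fin n) × EuclideanSpace ℝ (Fin n) =>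
      (WithLp.toLp 2 (Sum.elim p.1 p.2) : EuclideanSpace ℝ (Fin n ⊕ Fin n))) =
      WithLp.toLp 2 ∘ (MeasurableEquiv.sumPiEquivProdPi fun _ : Fin n ⊕ Fin n => ℝ).symm ∘
        Prod.map WithLp.ofLp WithLp.ofLp := by
    ext p i
    rcases i with i | i <;> rfl
  rw [he]
  exact h

/-- The shear `(x, q) ↦ (x, x + q)` preserves Lebesgue measure: after Tonelli, the inner integral
over `q` is translation invariant. -/
theorem lintegral_diagShift {F : EuclideanSpace ℝ (Fin n ⊕ Fin n) → ℝ≥0∞} (hF : Measurable F) :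
    ∫⁻ q, ∫⁻ x, F (diagShift (n := n) q x) = ∫⁻ z, F z := by
  have hm : Measurable (Function.uncurry fun q x => F (diagShift (n := n) q x)) :=
    hF.comp continuous_diagShift.measurable
  rw [lintegral_lintegral_swap hm.aemeasurable]
  have hm' : Measurable fun p : EuclideanSpace ℝ (Fin n) × EuclideanSpace ℝ (Fin n) =>
      F (WithLp.toLp 2 (Sum.elim p.1 p.2)) := hF.comp measurePreserving_toLp_sumElim.measurable
  rw [← measurePreserving_toLp_sumElim.lintegral_comp hF, Measure.volume_eq_prod,
    lintegral_prod _ hm'.aemeasurable]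
  refine lintegral_congr fun x => ?_
  exact lintegral_add_left_eq_self (μ := (volume : Measure (EuclideanSpace ℝ (Fin n))))
    (fun y => F (WithLp.toLp 2 (Sum.elim x y))) x

/-- The phase `exp (-i Re ζ · Im ζ)`. -/
def bellPhase (ζ : Fin n → ℂ) : ℂ :=
  Complex.exp (((-∑ k, (ζ k).re * (ζ k).im : ℝ) : ℂ) * Complex.I)

theorem norm_bellPhase (ζ : Fin n → ℂ) : ‖bellPhase ζ‖ = 1 :=
  Complex.norm_exp_ofReal_mul_I _

theorem continuous_bellPhase : Continuous (bellPhase (n := n)) := by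
  unfold bellPhase
  fun_prop

/-- Up to a phase, the Bell amplitude is a Fourier transform along the diagonal. -/
theorem bellAmplitude_eq (ζ : Fin n → ℂ) (f : 𝓢(EuclideanSpace ℝ (Fin n ⊕ Fin n), ℂ)) :
    bellAmplitude ζ f = bellPhase ζ *
      𝓕 (diagSection (√2 • WithLp.toLp 2 fun k => (ζ k).re) f)
        ((√2 * Real.pi)⁻¹ • WithLp.toLp 2 fun k => (ζ k).im) := by
  rw [SchwartzMap.fourier_coe, Real.fourier_eq', bellAmplitude, ← integral_const_mul]
  refine integral_congr_ae (Filter.Eventually.of_forall fun x => ?_)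
  have hs : (WithLp.toLp 2 (Sum.elim x x) : EuclideanSpace ℝ (Fin n ⊕ Fin n)) -
      positionShift (Sum.elim 0 (-ζ)) = diagShift (√2 • WithLp.toLp 2 fun k => (ζ k).re) x := by
    ext i
    rcases i with i | i <;> simp [diagShift, positionShift]
  simp only [displaceFun, hs, diagSection_apply, smul_eq_mul, ← mul_assoc]
  congr 1
  rw [displacementPhase, bellPhase, ← Complex.exp_add, ← add_mul, ← Complex.ofReal_add]
  congr 3
  -- The frequency `Im ζ / (√2 π)` turns the kernel `exp (-2πi ⟨x, ξ⟩)` into the phase `exp (-i √2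
  -- Im ζ · x)` of `D(-ζ)`.
  have h2 : 2 * Real.pi * (√2 * Real.pi)⁻¹ = √2 := by
    have := Real.pi_pos
    field_simp
    norm_num
  rw [inner_smul_right, PiLp.inner_apply]
  simp only [Fintype.sum_sum_type, Sum.elim_inl, Sum.elim_inr, Pi.zero_apply, Complex.zero_re,
    Complex.zero_im, zero_mul, Finset.sum_const_zero, zero_add, Pi.neg_apply, Complex.neg_re,
    Complex.neg_im, RCLike.inner_apply, conj_trivial, neg_mul, Finset.sum_neg_distrib,
    mul_neg, neg_neg]
  rw [← mul_assoc, h2]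

theorem measurable_fourier_diagSection (f : 𝓢(EuclideanSpace ℝ (Fin n ⊕ Fin n), ℂ)) :
    Measurable fun p : EuclideanSpace ℝ (Fin n) × EuclideanSpace ℝ (Fin n) =>
      𝓕 (diagSection p.1 f) p.2 := by
  have hc : Continuous fun t : (EuclideanSpace ℝ (Fin n) × EuclideanSpace ℝ (Fin n)) ×
      EuclideanSpace ℝ (Fin n) =>
      Complex.exp (((-2 * Real.pi * ⟪t.2, t.1.2⟫_ℝ : ℝ) : ℂ) * Complex.I) •
        f (diagShift t.1.1 t.2) := by
    have h1 : Continuous fun t : (EuclideanSpace ℝ (Fin n) × EuclideanSpace ℝ (Fin n)) ×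
        EuclideanSpace ℝ (Fin n) => diagShift t.1.1 t.2 :=
      continuous_diagShift.comp (continuous_fst.fst.prodMk continuous_snd)
    have h2 := f.continuous.comp h1
    simp only [Function.comp_def] at h2
    fun_prop
  have h := (hc.stronglyMeasurable.integral_prod_right' (ν := volume)).measurable
  convert h using 2 with p
  rw [SchwartzMap.fourier_coe, Real.fourier_eq']
  rfl

theorem measurable_bellAmplitude (f : 𝓢(EuclideanSpace ℝ (Fin n ⊕ Fin n), ℂ)) :
    Measurable fun ζ => bellAmplitude ζ f := by
  simp only [bellAmplitude_eq]
  refine continuous_bellPhase.measurable.mul ?_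
  have hg : Measurable fun p : EuclideanSpace ℝ (Fin n) × EuclideanSpace ℝ (Fin n) =>
      (√2 • p.1, (√2 * Real.pi)⁻¹ • p.2) := by fun_prop
  have h := (measurable_fourier_diagSection f).comp (hg.comp measurePreserving_re_im.measurable)
  exact h

/-- Plancherel on each shifted diagonal, then the shear. Rescaling the frequency contributes `(√2
π)^n` and rescaling the shift contributes `√2^{-n}`, so `π^{-n}` is exactly the normalization that
makes the transform isometric. -/
theorem lintegral_norm_sq_bellAmplitude (f : 𝓢(EuclideanSpace ℝ (Fin n ⊕ Fin n), ℂ)) :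
    ∫⁻ ζ : Fin n → ℂ, ENNReal.ofReal ((1 / Real.pi ^ n) * ‖bellAmplitude ζ f‖ ^ 2) =
      ∫⁻ z, ENNReal.ofReal (‖f z‖ ^ 2) := by
  have hπ := Real.pi_pos
  set G : EuclideanSpace ℝ (Fin n) × EuclideanSpace ℝ (Fin n) → ℝ≥0∞ := fun p =>
    ENNReal.ofReal (‖𝓕 (diagSection p.1 f) p.2‖ ^ 2) with hG
  have hGm : Measurable G := by
    have := measurable_fourier_diagSection f
    fun_prop
  have hg : Measurable fun p : EuclideanSpace ℝ (Fin n) × EuclideanSpace ℝ (Fin n) =>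
      (√2 • p.1, (√2 * Real.pi)⁻¹ • p.2) := by fun_prop
  have hs2 : (0 : ℝ) < √2 := by positivity
  calc _ = ENNReal.ofReal (1 / Real.pi ^ n) * ∫⁻ ζ : Fin n → ℂ,
        (fun p : EuclideanSpace ℝ (Fin n) × EuclideanSpace ℝ (Fin n) =>
          G (√2 • p.1, (√2 * Real.pi)⁻¹ • p.2))
        (WithLp.toLp 2 fun k => (ζ k).re, WithLp.toLp 2 fun k => (ζ k).im) := by
        rw [← lintegral_const_mul']
        · refine lintegral_congr fun ζ => ?_
          rw [ENNReal.ofReal_mul (by positivity), bellAmplitude_eq, norm_mul, norm_bellPhase,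
            one_mul]
        · exact ENNReal.ofReal_ne_top
    _ = ENNReal.ofReal (1 / Real.pi ^ n) * ∫⁻ a : EuclideanSpace ℝ (Fin n),
          ∫⁻ b : EuclideanSpace ℝ (Fin n), G (√2 • a, (√2 * Real.pi)⁻¹ • b) := by
        have hGg : Measurable fun p : EuclideanSpace ℝ (Fin n) × EuclideanSpace ℝ (Fin n) =>
            G (√2 • p.1, (√2 * Real.pi)⁻¹ • p.2) := hGm.comp hg
        rw [measurePreserving_re_im.lintegral_comp hGg, Measure.volume_eq_prod,
          lintegral_prod _ hGg.aemeasurable]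
    _ = ∫⁻ q : EuclideanSpace ℝ (Fin n), ∫⁻ x : EuclideanSpace ℝ (Fin n),
          ENNReal.ofReal (‖f (diagShift q x)‖ ^ 2) := by
        have h1 : ∀ a : EuclideanSpace ℝ (Fin n),
            ∫⁻ b : EuclideanSpace ℝ (Fin n), G (√2 • a, (√2 * Real.pi)⁻¹ • b) =
            ENNReal.ofReal ((√2 * Real.pi) ^ n) * ∫⁻ x : EuclideanSpace ℝ (Fin n),
              ENNReal.ofReal (‖f (diagShift (√2 • a) x)‖ ^ 2) := fun a => by
          rw [lintegral_comp_smul_of_pos volume (fun b => G (√2 • a, b)) (by positivity), hG]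
          simp only [SchwartzMap.lintegral_norm_sq_fourier, diagSection_apply,
            finrank_euclideanSpace, Fintype.card_fin, inv_pow, inv_inv]
        simp only [h1]
        rw [lintegral_const_mul' _ _ ENNReal.ofReal_ne_top,
          lintegral_comp_smul_of_pos volume (fun q : EuclideanSpace ℝ (Fin n) =>
            ∫⁻ x : EuclideanSpace ℝ (Fin n), ENNReal.ofReal (‖f (diagShift q x)‖ ^ 2)) hs2,
          ← mul_assoc, ← mul_assoc, ← ENNReal.ofReal_mul (by positivity),
          ← ENNReal.ofReal_mul (by positivity), finrank_euclideanSpace, Fintype.card_fin]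
        have : 1 / Real.pi ^ n * (√2 * Real.pi) ^ n * (√2 ^ n)⁻¹ = 1 := by
          rw [mul_pow]; field_simp
        rw [this, ENNReal.ofReal_one, one_mul]
    _ = _ := lintegral_diagShift (F := fun z => ENNReal.ofReal (‖f z‖ ^ 2))
        (by have := f.continuous; fun_prop)

end BellTransform

/-! ### Displacements preserve Schwartz functions. -/

section ExpGrowth

theorem iteratedDeriv_exp_ofReal_mul_I (m : ℕ) :
    iteratedDeriv m (fun t : ℝ => Complex.exp (t * Complex.I)) =
      fun t : ℝ => Complex.I ^ m * Complex.exp (t * Complex.I) := by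
  induction m with
  | zero => simp
  | succ m ih =>
    rw [iteratedDeriv_succ, ih]
    funext t
    have h : HasDerivAt (fun t : ℝ => Complex.exp (t * Complex.I))
        (Complex.exp (t * Complex.I) * (1 * Complex.I)) t :=
      ((Complex.ofRealCLM.hasDerivAt (x := t)).mul_const Complex.I).cexp
    rw [(h.const_mul _).deriv]
    ring

theorem hasTemperateGrowth_exp_ofReal_mul_I :
    Function.HasTemperateGrowth fun t : ℝ => Complex.exp (t * Complex.I) := by
  refine ⟨(Complex.ofRealCLM.contDiff.mul contDiff_const).cexp, fun m => ⟨0, 1, fun t => ?_⟩⟩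
  rw [norm_iteratedFDeriv_eq_norm_iteratedDeriv, iteratedDeriv_exp_ofReal_mul_I]
  simp [Complex.norm_exp_ofReal_mul_I]

theorem hasTemperateGrowth_displacementPhase {ι : Type} [Fintype ι] (α : ι → ℂ) :
    Function.HasTemperateGrowth (displacementPhase α) := by
  have h : Function.HasTemperateGrowth fun x : EuclideanSpace ℝ ι =>
      -(∑ k, (α k).re * (α k).im) + √2 * ∑ k, (α k).im * x k := by
    refine (Function.HasTemperateGrowth.const _).add
      ((Function.HasTemperateGrowth.const _).mul ?_)
    refine Function.HasTemperateGrowth.sum fun k _ => ?_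
    exact (Function.HasTemperateGrowth.const _).mul
      (EuclideanSpace.proj k : EuclideanSpace ℝ ι →L[ℝ] ℝ).hasTemperateGrowth
  exact hasTemperateGrowth_exp_ofReal_mul_I.comp h

end ExpGrowth

noncomputable section DisplacedSchwartz

variable {ι : Type} [Fintype ι]

/-- The displacement of a Schwartz function. -/
def displaceSchwartz (α : ι → ℂ) (f : 𝓢(EuclideanSpace ℝ ι, ℂ)) : 𝓢(EuclideanSpace ℝ ι, ℂ) :=
  SchwartzMap.smulLeftCLM ℂ (displacementPhase α) (f.compSubConstCLM ℂ (positionShift α))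

theorem displaceSchwartz_apply (α : ι → ℂ) (f : 𝓢(EuclideanSpace ℝ ι, ℂ))
    (x : EuclideanSpace ℝ ι) : displaceSchwartz α f x = displaceFun α f x :=
  SchwartzMap.smulLeftCLM_apply_apply (hasTemperateGrowth_displacementPhase α) _ _

theorem displacement_toLp (α : ι → ℂ) (f : 𝓢(EuclideanSpace ℝ ι, ℂ)) :
    displacement α (f.toLp 2) = (displaceSchwartz α f).toLp 2 := by
  refine MemLp.toLp_congr (memLp_displaceFun α (Lp.memLp _)) _
    ((displaceFun_congr_ae α (f.coeFn_toLp 2)).trans ?_)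
  exact Filter.Eventually.of_forall fun x => (displaceSchwartz_apply α f x).symm

end DisplacedSchwartz

/-! ### The Bell isometry and its covariance on Schwartz functions. -/

noncomputable section BellIsometry

variable {n : ℕ}

/-- The character `ζ ↦ exp (ζ^* · α^* - ζ · α)`. -/
def bellChar (α ζ : Fin n → ℂ) : ℂ :=
  Complex.exp (∑ k, (starRingEnd ℂ (ζ k) * starRingEnd ℂ (α k) - ζ k * α k))

/-- With `w = ζ_k α_k`, the exponent is `conj w - w = -2i Im w`, hence purely imaginary. -/
theorem bellChar_eq (α ζ : Fin n → ℂ) :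
    bellChar α ζ = Complex.exp
      (((∑ k, -2 * ((ζ k).re * (α k).im + (ζ k).im * (α k).re) : ℝ) : ℂ) * Complex.I) := by
  rw [bellChar, Complex.ofReal_sum, Finset.sum_mul]
  congr 1
  refine Finset.sum_congr rfl fun k _ => ?_
  apply Complex.ext
  · simp
  · simp; ring

theorem norm_bellChar (α ζ : Fin n → ℂ) : ‖bellChar α ζ‖ = 1 := by
  rw [bellChar_eq, Complex.norm_exp_ofReal_mul_I]

theorem measurable_bellChar (α : Fin n → ℂ) : Measurable (bellChar α) := by
  unfold bellChar
  have : Continuous (starRingEnd ℂ) := Complex.continuous_conj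
  fun_prop

/-- Since `α` and `α^*` have equal real parts, both arguments shift by the same vector, and
translating the integration variable along the diagonal undoes this. Their imaginary parts are
opposite, so the phases linear in `x` cancel and only a constant phase, the character, remains. -/
theorem bellAmplitude_displaceSchwartz (α ζ : Fin n → ℂ)
    (f : 𝓢(EuclideanSpace ℝ (Fin n ⊕ Fin n), ℂ)) :
    bellAmplitude ζ (displaceSchwartz (Sum.elim α fun k => starRingEnd ℂ (α k)) f) =
      bellChar α ζ * bellAmplitude ζ f := by
  rw [bellAmplitude, bellAmplitude, ← integral_const_mul,
    ← integral_add_right_eq_self _ (positionShift α)]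
  refine integral_congr_ae (Filter.Eventually.of_forall fun x => ?_)
  have hs : (WithLp.toLp 2 (Sum.elim (WithLp.ofLp (x + positionShift α))
        (WithLp.ofLp (x + positionShift α))) :
        EuclideanSpace ℝ (Fin n ⊕ Fin n)) - positionShift (Sum.elim 0 (-ζ)) -
        positionShift (Sum.elim α fun k => starRingEnd ℂ (α k)) =
      WithLp.toLp 2 (Sum.elim x x) - positionShift (Sum.elim 0 (-ζ)) := by
    ext i
    rcases i with i | i
    · simp [positionShift]
    · simp [positionShift]; ring
  simp only [displaceFun, displaceSchwartz_apply, hs, ← mul_assoc]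
  congr 1
  simp only [displacementPhase, bellChar_eq, ← Complex.exp_add, ← add_mul, ← Complex.ofReal_add]
  congr 3
  have h2 : √2 * √2 = (2 : ℝ) := Real.mul_self_sqrt (by norm_num)
  simp only [Fintype.sum_sum_type, Sum.elim_inl, Sum.elim_inr, Finset.mul_sum,
    ← Finset.sum_neg_distrib, ← Finset.sum_add_distrib]
  refine Finset.sum_congr rfl fun k _ => ?_
  simp [positionShift]
  linear_combination (-(ζ k).im * (α k).re - (α k).im * (ζ k).re) * h2

theorem eLpNorm_two_eq {X : Type*} [MeasurableSpace X] (μ : Measure X) (g : X → ℂ) :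
    eLpNorm g 2 μ = (∫⁻ x, ENNReal.ofReal (‖g x‖ ^ 2) ∂μ) ^ (1 / 2 : ℝ) := by
  rw [eLpNorm_eq_lintegral_rpow_enorm_toReal (by norm_num) (by norm_num)]
  have h : ∀ x, ‖g x‖ₑ ^ (2 : ℝ≥0∞).toReal = ENNReal.ofReal (‖g x‖ ^ 2) := fun x => by
    rw [ENNReal.ofReal_pow (norm_nonneg _), ofReal_norm, ENNReal.toReal_ofNat]
    exact ENNReal.rpow_natCast _ 2
  simp only [h]
  norm_num

/-- The wave function `ζ ↦ π^{-n/2} ⟨Ψ(ζ)|f⟩` of a Schwartz function. -/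
def bellWave (f : 𝓢(EuclideanSpace ℝ (Fin n ⊕ Fin n), ℂ)) (ζ : Fin n → ℂ) : ℂ :=
  ((√(Real.pi ^ n))⁻¹ : ℝ) * bellAmplitude ζ f

theorem norm_sq_bellWave (f : 𝓢(EuclideanSpace ℝ (Fin n ⊕ Fin n), ℂ)) (ζ : Fin n → ℂ) :
    ‖bellWave f ζ‖ ^ 2 = (1 / Real.pi ^ n) * ‖bellAmplitude ζ f‖ ^ 2 := by
  have := Real.pi_pos
  rw [bellWave, norm_mul, mul_pow, Complex.norm_real, Real.norm_of_nonneg (by positivity),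
    inv_pow, Real.sq_sqrt (by positivity), one_div]

theorem eLpNorm_bellWave (f : 𝓢(EuclideanSpace ℝ (Fin n ⊕ Fin n), ℂ)) :
    eLpNorm (bellWave f) 2 volume = eLpNorm f 2 volume := by
  simp only [eLpNorm_two_eq, norm_sq_bellWave, lintegral_norm_sq_bellAmplitude]

theorem memLp_bellWave (f : 𝓢(EuclideanSpace ℝ (Fin n ⊕ Fin n), ℂ)) :
    MemLp (bellWave f) 2 volume := by
  have h : Measurable (bellWave f) := by
    unfold bellWave
    exact (measurable_bellAmplitude f).const_mul _
  exact ⟨h.aestronglyMeasurable, (eLpNorm_bellWave f).trans_lt (f.memLp 2 volume).2⟩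

/-- `f ↦ π^{-n/2} ⟨Ψ(·)|f⟩` as a linear map from Schwartz functions to `L²(ℂ^n)`. -/
def bellLinearMap : 𝓢(EuclideanSpace ℝ (Fin n ⊕ Fin n), ℂ) →ₗ[ℂ]
    Lp ℂ 2 (volume : Measure (Fin n → ℂ)) where
  toFun f := (memLp_bellWave f).toLp
  map_add' f g := by
    rw [← MemLp.toLp_add]
    refine MemLp.toLp_congr _ _ (Filter.Eventually.of_forall fun ζ => ?_)
    simp only [bellWave, bellAmplitude_eq, map_add, FourierTransform.fourier_add,
      _root_.add_apply, Pi.add_apply]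
    ring
  map_smul' c f := by
    rw [RingHom.id_apply, ← MemLp.toLp_const_smul]
    refine MemLp.toLp_congr _ _ (Filter.Eventually.of_forall fun ζ => ?_)
    simp only [bellWave, bellAmplitude_eq, map_smul, FourierTransform.fourier_smul,
      _root_.smul_apply, Pi.smul_apply, smul_eq_mul]
    ring

theorem norm_bellLinearMap (f : 𝓢(EuclideanSpace ℝ (Fin n ⊕ Fin n), ℂ)) :
    ‖bellLinearMap f‖ = ‖f.toLp 2‖ := by
  rw [SchwartzMap.norm_toLp, ← eLpNorm_bellWave]
  exact Lp.norm_toLp _ (memLp_bellWave f)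

theorem denseRange_schwartz_toLp (ι : Type) [Fintype ι] :
    DenseRange (SchwartzMap.toLpCLM ℂ (E := EuclideanSpace ℝ ι) ℂ 2 volume) :=
  SchwartzMap.denseRange_toLpCLM (by norm_num)

/-- The isometry `L²(ℝ^{2n}) → L²(ℂ^n)` that diagonalizes the Bell measurement. -/
def bellTransform : ModeSpace (Fin n ⊕ Fin n) →L[ℂ] Lp ℂ 2 (volume : Measure (Fin n → ℂ)) :=
  bellLinearMap.extendOfNorm (SchwartzMap.toLpCLM ℂ ℂ 2 volume).toLinearMap

theorem bellTransform_toLp (f : 𝓢(EuclideanSpace ℝ (Fin n ⊕ Fin n), ℂ)) :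
    bellTransform (f.toLp 2) = (memLp_bellWave f).toLp :=
  LinearMap.extendOfNorm_eq (denseRange_schwartz_toLp _)
    ⟨1, fun f => by rw [one_mul]; exact (norm_bellLinearMap f).le⟩ f

theorem norm_bellTransform (ψ : ModeSpace (Fin n ⊕ Fin n)) : ‖bellTransform ψ‖ = ‖ψ‖ := by
  refine (denseRange_schwartz_toLp _).induction_on
    (p := fun ψ => ‖bellTransform ψ‖ = ‖ψ‖) ψ (isClosed_eq (by fun_prop) (by fun_prop))
    fun f => ?_
  rw [SchwartzMap.toLpCLM_apply, bellTransform_toLp]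
  exact norm_bellLinearMap f

theorem inner_bellTransform (φ ψ : ModeSpace (Fin n ⊕ Fin n)) :
    ⟪bellTransform φ, bellTransform ψ⟫_ℂ = ⟪φ, ψ⟫_ℂ :=
  LinearIsometry.inner_map_map ⟨bellTransform.toLinearMap, norm_bellTransform⟩ φ ψ

end BellIsometry

/-! ### Multiplication operators, and displacements in the Bell representation. -/

noncomputable section Multiplication

variable {X : Type*} [MeasurableSpace X]

theorem memLp_mul_of_norm_le_one {μ : Measure X} {g : X → ℂ} (hg : Measurable g) (hb : ∀ x, ‖g x‖ ≤ 1)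
    {ψ : X → ℂ} (hψ : MemLp ψ 2 μ) : MemLp (fun x => g x * ψ x) 2 μ := by
  refine MemLp.of_le hψ (hg.aestronglyMeasurable.mul hψ.1) (Filter.Eventually.of_forall fun x => ?_)
  rw [norm_mul]
  exact mul_le_of_le_one_left (norm_nonneg _) (hb x)

/-- Multiplication by a measurable function of modulus at most one on `L²`. -/
def mulOp (μ : Measure X) (g : X → ℂ) (hg : Measurable g) (hb : ∀ x, ‖g x‖ ≤ 1) :
    Lp ℂ 2 μ →L[ℂ] Lp ℂ 2 μ :=
  LinearMap.mkContinuous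
    { toFun := fun ψ => (memLp_mul_of_norm_le_one hg hb (Lp.memLp ψ)).toLp
      map_add' := fun ψ φ => by
        rw [← MemLp.toLp_add]
        refine MemLp.toLp_congr _ _ ?_
        filter_upwards [Lp.coeFn_add ψ φ] with x hx
        rw [hx, Pi.add_apply, Pi.add_apply, mul_add]
      map_smul' := fun c ψ => by
        rw [RingHom.id_apply, ← MemLp.toLp_const_smul]
        refine MemLp.toLp_congr _ _ ?_
        filter_upwards [Lp.coeFn_smul c ψ] with x hx
        rw [hx, Pi.smul_apply, Pi.smul_apply, smul_eq_mul, smul_eq_mul, mul_left_comm] }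
    1 fun ψ => by
      rw [one_mul]
      refine Lp.norm_le_norm_of_ae_le ?_
      filter_upwards [(memLp_mul_of_norm_le_one hg hb (Lp.memLp ψ)).coeFn_toLp] with x hx
      simp only [LinearMap.coe_mk, AddHom.coe_mk, hx, norm_mul]
      exact mul_le_of_le_one_left (norm_nonneg _) (hb x)

theorem coeFn_mulOp {μ : Measure X} {g : X → ℂ} (hg : Measurable g) (hb : ∀ x, ‖g x‖ ≤ 1) (ψ : Lp ℂ 2 μ) :
    mulOp μ g hg hb ψ =ᵐ[μ] fun x => g x * ψ x :=
  (memLp_mul_of_norm_le_one hg hb (Lp.memLp ψ)).coeFn_toLp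

theorem inner_mulOp {μ : Measure X} {g : X → ℂ} (hg : Measurable g) (hb : ∀ x, ‖g x‖ ≤ 1) (φ ψ : Lp ℂ 2 μ) :
    ⟪φ, mulOp μ g hg hb ψ⟫_ℂ = ∫ x, g x * ⟪φ x, ψ x⟫_ℂ ∂μ := by
  rw [L2.inner_def]
  refine integral_congr_ae ?_
  filter_upwards [coeFn_mulOp hg hb ψ] with x hx
  rw [hx, ← smul_eq_mul (g x) (ψ x), inner_smul_right]

end Multiplication

section Covariance

variable {n : ℕ}

/-- In the Bell representation, `D(α) ⊗ D(α^*)` is multiplication by a character. -/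
theorem bellTransform_displacement (α : Fin n → ℂ) (ψ : ModeSpace (Fin n ⊕ Fin n)) :
    bellTransform (displacement (Sum.elim α fun k => starRingEnd ℂ (α k)) ψ) =
      mulOp volume (bellChar α) (measurable_bellChar α) (fun ζ => (norm_bellChar α ζ).le)
        (bellTransform ψ) := by
  refine (denseRange_schwartz_toLp _).induction_on
    (p := fun ψ => bellTransform (displacement (Sum.elim α fun k => starRingEnd ℂ (α k)) ψ) =
      mulOp volume (bellChar α) (measurable_bellChar α) (fun ζ => (norm_bellChar α ζ).le)
        (bellTransform ψ)) ψ (isClosed_eq (by fun_prop) (by fun_prop)) fun f => ?_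
  rw [SchwartzMap.toLpCLM_apply, displacement_toLp, bellTransform_toLp, bellTransform_toLp]
  refine MemLp.toLp_congr _ (memLp_mul_of_norm_le_one (measurable_bellChar α)
    (fun ζ => (norm_bellChar α ζ).le) (Lp.memLp _)) ?_
  filter_upwards [(memLp_bellWave f).coeFn_toLp] with ζ hζ
  rw [hζ, bellWave, bellWave, bellAmplitude_displaceSchwartz]
  ring

end Covariance

section Trace

variable {H : Type} [NormedAddCommGroup H] [InnerProductSpace ℂ H] [CompleteSpace H]

/-- Guarantees that `opTrace`, and hence `charFn`, is a genuine trace here and not the default value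
`0`. -/
theorem DensityOperator.hasTrace_comp (ρ : DensityOperator H) (T : H →L[ℂ] H) :
    HasTrace (ρ.op ∘L T) (opTrace (ρ.op ∘L T)) := by
  obtain ⟨κ, v, hv, hρ⟩ := ρ.exists_ensemble
  have h := hasTrace_comp_of_ensemble hv.summable hρ T
  rwa [h.opTrace_eq]

end Trace

/-! ### Existence and uniqueness of the Bell measurement. -/

noncomputable section BellPOVM

variable {n : ℕ}

theorem norm_indicator_one_le {X : Type*} (B : Set X) (x : X) :
    ‖B.indicator (fun _ => (1 : ℂ)) x‖ ≤ 1 := by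
  by_cases h : x ∈ B <;> simp [h]

/-- The operator diagonal in the Bell representation that multiplies by `g`. -/
def bellDiagonal (g : (Fin n → ℂ) → ℂ) (hg : Measurable g) (hb : ∀ ζ, ‖g ζ‖ ≤ 1) :
    ModeSpace (Fin n ⊕ Fin n) →L[ℂ] ModeSpace (Fin n ⊕ Fin n) :=
  ContinuousLinearMap.adjoint bellTransform ∘L mulOp volume g hg hb ∘L bellTransform

theorem inner_bellDiagonal {g : (Fin n → ℂ) → ℂ} (hg : Measurable g) (hb : ∀ ζ, ‖g ζ‖ ≤ 1)
    (φ ψ : ModeSpace (Fin n ⊕ Fin n)) :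
    ⟪φ, bellDiagonal g hg hb ψ⟫_ℂ =
      ∫ ζ, g ζ * ⟪bellTransform φ ζ, bellTransform ψ ζ⟫_ℂ := by
  rw [← inner_mulOp hg hb, ← ContinuousLinearMap.adjoint_inner_right]
  rfl

/-- Covariance reads `V D = M V`, with `D` the displacement and `M` multiplication by the character;
applying `V*` and `V* V = 1` gives `V* M V = D`. -/
theorem bellDiagonal_bellChar (α : Fin n → ℂ) :
    bellDiagonal (bellChar α) (measurable_bellChar α) (fun ζ => (norm_bellChar α ζ).le) =
      displacement (Sum.elim α fun k => starRingEnd ℂ (α k)) := by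
  ext1 ψ
  refine ext_inner_left ℂ fun φ => ?_
  rw [inner_bellDiagonal, ← inner_mulOp (measurable_bellChar α) fun ζ => (norm_bellChar α ζ).le,
    ← bellTransform_displacement, inner_bellTransform]

open Classical in
/-- The effects of the Bell measurement. -/
def bellEffect (B : Set (Fin n → ℂ)) :
    ModeSpace (Fin n ⊕ Fin n) →L[ℂ] ModeSpace (Fin n ⊕ Fin n) :=
  if h : MeasurableSet B then
    bellDiagonal (B.indicator fun _ => 1) (measurable_const.indicator h) (norm_indicator_one_le B)
  else 0

theorem inner_bellEffect {B : Set (Fin n → ℂ)} (hB : MeasurableSet B)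
    (φ ψ : ModeSpace (Fin n ⊕ Fin n)) :
    ⟪φ, bellEffect B ψ⟫_ℂ = ∫ ζ in B, ⟪bellTransform φ ζ, bellTransform ψ ζ⟫_ℂ := by
  rw [bellEffect, dif_pos hB, inner_bellDiagonal, ← integral_indicator hB]
  refine integral_congr_ae (Filter.Eventually.of_forall fun ζ => ?_)
  by_cases h : ζ ∈ B <;> simp [h]

theorem inner_bellEffect_self {B : Set (Fin n → ℂ)} (hB : MeasurableSet B)
    (ψ : ModeSpace (Fin n ⊕ Fin n)) :
    ⟪ψ, bellEffect B ψ⟫_ℂ = ((∫ ζ in B, ‖bellTransform ψ ζ‖ ^ 2 : ℝ) : ℂ) := by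
  rw [inner_bellEffect hB, ← integral_complex_ofReal]
  simp [inner_self_eq_norm_sq_to_K]

theorem isPositive_bellEffect {B : Set (Fin n → ℂ)} (hB : MeasurableSet B) :
    (bellEffect B).IsPositive := by
  rw [ContinuousLinearMap.isPositive_iff_complex]
  intro ψ
  rw [← inner_conj_symm, inner_bellEffect_self hB, Complex.conj_ofReal]
  simp only [RCLike.re_to_complex, Complex.ofReal_re, true_and]
  positivity

/-- The continuous-variable Bell measurement. -/
def bellPOVM (n : ℕ) : POVM (Fin n → ℂ) (ModeSpace (Fin n ⊕ Fin n)) where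
  effect := bellEffect
  isPositive _ hB := isPositive_bellEffect hB
  effect_univ := by
    ext1 ψ
    refine ext_inner_left ℂ fun φ => ?_
    rw [inner_bellEffect MeasurableSet.univ, Measure.restrict_univ, ← L2.inner_def,
      inner_bellTransform]
    rfl
  hasSum_effect B hB hd φ ψ := by
    simp only [inner_bellEffect (hB _), inner_bellEffect (MeasurableSet.iUnion hB)]
    exact hasSum_integral_iUnion hB (fun i j hij => hd i j hij)
      (L2.integrable_inner _ _).integrableOn

theorem ofReal_re_inner_bellEffect {B : Set (Fin n → ℂ)} (hB : MeasurableSet B)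
    (ψ : ModeSpace (Fin n ⊕ Fin n)) :
    ENNReal.ofReal (⟪ψ, bellEffect B ψ⟫_ℂ).re =
      ∫⁻ ζ in B, ENNReal.ofReal (‖bellTransform ψ ζ‖ ^ 2) := by
  have hi : Integrable (fun ζ => ‖bellTransform ψ ζ‖ ^ 2) (volume.restrict B) :=
    ((Lp.memLp (bellTransform ψ)).integrable_norm_pow (by norm_num)).restrict
  rw [inner_bellEffect_self hB, Complex.ofReal_re, ofReal_integral_eq_lintegral_ofReal hi
    (Filter.Eventually.of_forall fun ζ => by positivity)]

theorem setLIntegral_norm_sq_bellTransform_toLp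
    (f : 𝓢(EuclideanSpace ℝ (Fin n ⊕ Fin n), ℂ)) (B : Set (Fin n → ℂ)) :
    ∫⁻ ζ in B, ENNReal.ofReal (‖bellTransform (f.toLp 2) ζ‖ ^ 2) =
      ∫⁻ ζ in B, ENNReal.ofReal ((1 / Real.pi ^ n) * ‖bellAmplitude ζ f‖ ^ 2) := by
  have h : bellTransform (f.toLp 2) =ᵐ[volume] bellWave f := by
    rw [bellTransform_toLp]
    exact (memLp_bellWave f).coeFn_toLp
  simp only [← norm_sq_bellWave]
  refine lintegral_congr_ae ?_
  filter_upwards [ae_restrict_of_ae h] with ζ hζ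
  rw [hζ]

theorem isBellMeasurement_bellPOVM (n : ℕ) : IsBellMeasurement (bellPOVM n) := by
  intro f B hB
  refine (ofReal_re_inner_bellEffect hB (f.toLp 2)).trans ?_
  rw [setLIntegral_norm_sq_bellTransform_toLp f B]

/-- The density of Schwartz functions determines the effects of the Bell measurement. -/
theorem IsBellMeasurement.effect_eq {E E' : POVM (Fin n → ℂ) (ModeSpace (Fin n ⊕ Fin n))}
    (hE : IsBellMeasurement E) (hE' : IsBellMeasurement E') {B : Set (Fin n → ℂ)}
    (hB : MeasurableSet B) : E.effect B = E'.effect B := by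
  -- The defining identity sees only the real part, truncated at zero. Positivity of the effects
  -- makes the quadratic form real and nonnegative, so nothing is lost.
  have hpos : ∀ (F : POVM (Fin n → ℂ) (ModeSpace (Fin n ⊕ Fin n))) ψ,
      ⟪F.effect B ψ, ψ⟫_ℂ = ((⟪ψ, F.effect B ψ⟫_ℂ).re : ℂ) ∧ 0 ≤ (⟪ψ, F.effect B ψ⟫_ℂ).re :=
    fun F ψ => by
      have h := (ContinuousLinearMap.isPositive_iff_complex _).1 (F.isPositive B hB) ψ
      rw [← inner_conj_symm ψ, Complex.conj_re]
      exact ⟨h.1.symm, h.2⟩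
  -- Equality of the quadratic forms extends by density, and over `ℂ` polarization then gives
  -- equality of the operators.
  have hall : ∀ ψ, ⟪E.effect B ψ, ψ⟫_ℂ = ⟪E'.effect B ψ, ψ⟫_ℂ := fun ψ => by
    refine (denseRange_schwartz_toLp _).induction_on
      (p := fun ψ => ⟪E.effect B ψ, ψ⟫_ℂ = ⟪E'.effect B ψ, ψ⟫_ℂ) ψ
      (isClosed_eq (by fun_prop) (by fun_prop)) fun f => ?_
    rw [SchwartzMap.toLpCLM_apply, (hpos E _).1, (hpos E' _).1,
      (ENNReal.ofReal_eq_ofReal_iff (hpos E _).2 (hpos E' _).2).1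
        ((hE f B hB).trans (hE' f B hB).symm)]
  exact ContinuousLinearMap.coe_injective ((ext_inner_map _ _).1 hall)

end BellPOVM

/-! ### The outcome distribution and its characters. -/

noncomputable section OutcomeLaw

variable {n : ℕ} {κ : Type}

/-- The outcome distribution of the Bell measurement on the mixture `∑_j |v_j⟩⟨v_j|`. -/
def bellLaw (v : κ → ModeSpace (Fin n ⊕ Fin n)) : Measure (Fin n → ℂ) :=
  Measure.sum fun j => volume.withDensity fun ζ => ENNReal.ofReal (‖bellTransform (v j) ζ‖ ^ 2)

theorem aemeasurable_norm_sq_Lp {X : Type*} [MeasurableSpace X] {μ : Measure X} (φ : Lp ℂ 2 μ) :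
    AEMeasurable (fun x => ENNReal.ofReal (‖φ x‖ ^ 2)) μ := by
  have := (Lp.aestronglyMeasurable φ).norm.aemeasurable
  fun_prop

theorem lintegral_norm_sq_Lp {X : Type*} [MeasurableSpace X] {μ : Measure X} (φ : Lp ℂ 2 μ) :
    ∫⁻ x, ENNReal.ofReal (‖φ x‖ ^ 2) ∂μ = ENNReal.ofReal (‖φ‖ ^ 2) := by
  rw [← ofReal_integral_eq_lintegral_ofReal ((Lp.memLp φ).integrable_norm_pow (by norm_num))
    (Filter.Eventually.of_forall fun ζ => by positivity)]
  congr 1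
  have h : ((‖φ‖ ^ 2 : ℝ) : ℂ) = ((∫ x, ‖φ x‖ ^ 2 ∂μ : ℝ) : ℂ) := by
    rw [← integral_complex_ofReal, Complex.ofReal_pow]
    refine (inner_self_eq_norm_sq_to_K (𝕜 := ℂ) φ).symm.trans ?_
    rw [L2.inner_def]
    simp [inner_self_eq_norm_sq_to_K]
  exact_mod_cast h.symm

theorem isProbabilityMeasure_bellLaw {v : κ → ModeSpace (Fin n ⊕ Fin n)}
    (hv : HasSum (fun j => ‖v j‖ ^ 2) 1) : IsProbabilityMeasure (bellLaw v) := by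
  refine ⟨?_⟩
  rw [bellLaw, Measure.sum_apply _ MeasurableSet.univ]
  simp only [withDensity_apply _ MeasurableSet.univ, Measure.restrict_univ, lintegral_norm_sq_Lp,
    norm_bellTransform]
  rw [← ENNReal.ofReal_tsum_of_nonneg (fun j => by positivity) hv.summable, hv.tsum_eq,
    ENNReal.ofReal_one]

/-- Used twice: an indicator `g` yields the Born rule, and a character `g` yields the characteristic
function. -/
theorem integral_bellLaw {v : κ → ModeSpace (Fin n ⊕ Fin n)}
    (hv : HasSum (fun j => ‖v j‖ ^ 2) 1) {g : (Fin n → ℂ) → ℂ} (hg : Measurable g)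
    (hb : ∀ ζ, ‖g ζ‖ ≤ 1) :
    ∫ ζ, g ζ ∂(bellLaw v) = ∑' j, ⟪v j, bellDiagonal g hg hb (v j)⟫_ℂ := by
  have := isProbabilityMeasure_bellLaw hv
  have hi : Integrable g (bellLaw v) :=
    Integrable.of_bound hg.aestronglyMeasurable 1 (Filter.Eventually.of_forall hb)
  rw [bellLaw] at hi ⊢
  rw [integral_sum_measure hi]
  refine tsum_congr fun j => ?_
  rw [integral_withDensity_eq_integral_toReal_smul₀ (aemeasurable_norm_sq_Lp _)
    (Filter.Eventually.of_forall fun _ => ENNReal.ofReal_lt_top), inner_bellDiagonal]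
  refine integral_congr_ae (Filter.Eventually.of_forall fun ζ => ?_)
  simp only
  rw [ENNReal.toReal_ofReal (by positivity), inner_self_eq_norm_sq_to_K, mul_comm,
    Complex.real_smul]
  norm_num

/-- By uniqueness of the effects it suffices to treat `bellPOVM`, where the ensemble formula for the
trace matches `integral_bellLaw` term by term. -/
theorem IsBellMeasurement.exists_outcomeLaw {E : POVM (Fin n → ℂ) (ModeSpace (Fin n ⊕ Fin n))}
    (hE : IsBellMeasurement E) (ρ : DensityOperator (ModeSpace (Fin n ⊕ Fin n))) :
    ∃ P : Measure (Fin n → ℂ), E.IsOutcomeLaw ρ P ∧ ∀ α : Fin n → ℂ,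
      ∫ ζ, bellChar α ζ ∂P = charFn ρ α (fun k => starRingEnd ℂ (α k)) := by
  obtain ⟨κ, v, hv, hρ⟩ := ρ.exists_ensemble
  have hP := isProbabilityMeasure_bellLaw hv
  refine ⟨bellLaw v, ⟨hP, fun B hB => ?_⟩, fun α => ?_⟩
  · have h := hasTrace_comp_of_ensemble hv.summable hρ (bellEffect B)
    rw [bellEffect, dif_pos hB, ← integral_bellLaw hv, integral_indicator_const _ hB,
      Complex.real_smul, mul_one] at h
    rw [hE.effect_eq (isBellMeasurement_bellPOVM n) hB]
    change HasTrace (ρ.op ∘L bellEffect B) _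
    rwa [bellEffect, dif_pos hB]
  · have h := hasTrace_comp_of_ensemble hv.summable hρ
      (displacement (Sum.elim α fun k => starRingEnd ℂ (α k)))
    rw [integral_bellLaw hv (measurable_bellChar α) fun ζ => (norm_bellChar α ζ).le,
      bellDiagonal_bellChar, charFn, h.opTrace_eq]

end OutcomeLaw

/-! ### Unbiasedness of the estimator, and the main theorem. -/

section Estimator

variable {n N : ℕ}

theorem bellEstimator_eq (ζ : Fin N → Fin n → ℂ) (α : Fin n → ℂ) :
    bellEstimator ζ α = (1 / (N : ℂ)) * ∑ j, bellChar α (ζ j) := rfl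

variable (P : Measure (Fin n → ℂ)) [IsProbabilityMeasure P]

theorem integrable_bellChar (α : Fin n → ℂ) : Integrable (bellChar α) P :=
  Integrable.of_bound (measurable_bellChar α).aestronglyMeasurable 1
    (Filter.Eventually.of_forall fun ζ => (norm_bellChar α ζ).le)

theorem integrable_bellEstimator (α : Fin n → ℂ) :
    Integrable (fun ζ : Fin N → Fin n → ℂ => bellEstimator ζ α) (Measure.pi fun _ => P) := by
  simp only [bellEstimator_eq]
  exact (integrable_finsetSum _ fun j _ =>
    integrable_comp_eval (μ := fun _ : Fin N => P) (integrable_bellChar P α)).const_mul _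

theorem integral_bellEstimator (hN : 1 ≤ N) (α : Fin n → ℂ) :
    ∫ ζ : Fin N → Fin n → ℂ, bellEstimator ζ α ∂(Measure.pi fun _ => P) =
      ∫ ζ, bellChar α ζ ∂P := by
  simp only [bellEstimator_eq]
  have hN' : (N : ℂ) ≠ 0 := Nat.cast_ne_zero.2 (by lia)
  have h : ∀ j : Fin N, ∫ ζ : Fin N → Fin n → ℂ, bellChar α (ζ j) ∂(Measure.pi fun _ => P) =
      ∫ ζ, bellChar α ζ ∂P := fun j =>
    integral_comp_eval (μ := fun _ : Fin N => P) (measurable_bellChar α).aestronglyMeasurable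
  rw [integral_const_mul, integral_finsetSum _ fun j _ =>
    integrable_comp_eval (μ := fun _ : Fin N => P) (integrable_bellChar P α)]
  simp only [h, Finset.sum_const, Finset.card_univ, Fintype.card_fin, nsmul_eq_mul]
  field_simp

end Estimator

theorem mainTheorem10 :
    ∀ r : ℝ, 1 < r → ∃ C : ℝ, 0 < C ∧ ∀ n : ℕ,
      (∃ E : POVM (Fin n → ℂ) (ModeSpace (Fin n ⊕ Fin n)), IsBellMeasurement E) ∧
      ∀ E : POVM (Fin n → ℂ) (ModeSpace (Fin n ⊕ Fin n)), IsBellMeasurement E →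
      ∀ ρ : DensityOperator (ModeSpace (Fin n ⊕ Fin n)),
        (∀ α β : Fin n → ℂ,
          HasTrace (ρ.op ∘L displacement (Sum.elim α β)) (charFn ρ α β)) ∧
        ∃ P : Measure (Fin n → ℂ), E.IsOutcomeLaw ρ P ∧
          (∀ N : ℕ, 1 ≤ N → ∀ α : Fin n → ℂ,
            Integrable (fun ζ : Fin N → Fin n → ℂ => bellEstimator ζ α)
              (Measure.pi fun _ => P) ∧
            ∫ ζ : Fin N → Fin n → ℂ, bellEstimator ζ α ∂(Measure.pi fun _ => P) =
              charFn ρ α (fun k => starRingEnd ℂ (α k))) ∧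
          ∀ (ε δ : ℝ) (M N : ℕ), 0 < ε → 0 < δ → r ≤ (M : ℝ) / δ →
            C * (ε ^ 2)⁻¹ * Real.log ((M : ℝ) / δ) ≤ (N : ℝ) →
            ∀ α : Fin M → Fin n → ℂ,
              1 - δ ≤ (Measure.pi fun _ : Fin N => P).real
                {ζ | ∀ i, ‖bellEstimator ζ (α i) -
                  charFn ρ (α i) (fun k => starRingEnd ℂ (α i k))‖ ≤ ε} := by
  intro r hr
  have hlr : 0 < Real.log r := Real.log_pos hr
  have hl4 : 0 < Real.log 4 := Real.log_pos (by norm_num)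
  refine ⟨4 * (1 + Real.log 4 / Real.log r), by positivity, fun n =>
    ⟨⟨bellPOVM n, isBellMeasurement_bellPOVM n⟩, fun E hE ρ =>
      ⟨fun α β => ρ.hasTrace_comp _, ?_⟩⟩⟩
  obtain ⟨P, hP, hχ⟩ := hE.exists_outcomeLaw ρ
  have := hP.1
  refine ⟨P, hP, fun N hN α => ⟨integrable_bellEstimator P α, ?_⟩, ?_⟩
  · rw [integral_bellEstimator P hN, hχ]
  · intro ε δ M N hε hδ hM hN α
    have h := one_sub_le_measureReal_pi_mean_close P hr hε hδ hM hN
      (fun i => measurable_bellChar (α i)) fun i ζ => (norm_bellChar (α i) ζ).le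
    simpa only [hχ, ← bellEstimator_eq] using h
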